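/- Let $(M,g)$ be a complete, connected, non-compact Riemannian manifold of dimension $n$ with distance function $d$, and suppose that $M$ is harmonic: around each point $p$, the density $\sqrt{|\det(g_{ij})|}$ in normal coordinates depends, on some normal ball, only on the geodesic distance from $p$. Let $\Delta=-\operatorname{div}\operatorname{grad}$, let $\lambda\neq 0$ be an eigenvalue of $\Delta$ (i.e. $\Delta f=\lambda f$ for some smooth $f\not\equiv 0$ on $M$), and let $c\neq 0$ be a constant. Assume that all averaged eigenfunctions for $\lambda$ are of the form $\cosh r+c$, that is: for every smooth $f$ with $\Delta f=\lambda f$ and every $p\in M$, the average of $f$ over the geodesic spheres centred at $p$ is again a smooth solution of $\Delta\varphi=\lambda\varphi$, and it is a constant multiple of $$f_p=\cosh d(p,\cdot)+c .$$ Let $V_\lambda$ be the linear span of $\{f_p: p\in M\}$, and let $B$ be the symmetric bilinear form on $V_\lambda$ determined by $B(f_p,h)=h(p)$ for all $p\in M$ and $h\in V_\lambda$. For a unit speed geodesic $\gamma:\mathbb R\to M$, let $V_\gamma\subseteq V_\lambda$ be the subspace spanned by $\{f_{\gamma(t)}: t\in\mathbb R\}$. Then: 1. For every geodesic $\gamma$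 such that $V_\gamma$ is 3-dimensional, the restriction of $B$ to $V_\gamma$ is nondegenerate. 2. If $V_\gamma$ is 3-dimensional for every geodesic $\gamma$, then $M$ is a symmetric space: for every $p\in M$ there is an isometry of $M$ that fixes $p$ and maps $\gamma(t)$ to $\gamma(-t)$ for every geodesic $\gamma$ with $\gamma(0)=p$ and every $t\in\mathbb R$. -/

import Mathlib

open Set Manifold Bundle MeasureTheory
open scoped ContDiff

noncomputable section

namespace HarmonicSpace

/-- A unit speed geodesic defined on all of `ℝ`: a curve that locally realizes the Riemannian
distance between its points. -/
def IsGeodesic {M : Type*} [MetricSpace M] (γ : ℝ → M) : Prop :=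
  ∀ t : ℝ, ∃ ε > 0, ∀ s ∈ Ioo (t - ε) (t + ε), ∀ s' ∈ Ioo (t - ε) (t + ε),
    dist (γ s) (γ s') = |s - s'|

/-- `M` is a (globally) symmetric space: every point `p` admits an isometry of `M` fixing `p` and
reversing all geodesics through `p`. -/
def IsSymmetricSpace (M : Type*) [MetricSpace M] : Prop :=
  ∀ p : M, ∃ σ : M ≃ᵢ M, σ p = p ∧
    ∀ γ : ℝ → M, IsGeodesic γ → γ 0 = p → ∀ t : ℝ, σ (γ t) = γ (-t)

section Riemannian

variable {n : ℕ} {M : Type*} [MetricSpace M] [ChartedSpace (EuclideanSpace ℝ (Fin n)) M]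
  [RiemannianBundle (fun x : M => TangentSpace (𝓡 n) x)]

/-- The matrix `g_ij = g(∂_i, ∂_j)` of the Riemannian metric in a parametrization `ψ` of (a part
of) `M` by (a part of) `ℝⁿ`, at the parameter `y`. -/
def metricMatrix (ψ : EuclideanSpace ℝ (Fin n) → M) (y : EuclideanSpace ℝ (Fin n)) :
    Matrix (Fin n) (Fin n) ℝ :=
  Matrix.of fun i j =>
    inner ℝ
      (mfderiv (𝓡 n) (𝓡 n) ψ y (EuclideanSpace.single i (1 : ℝ)) : TangentSpace (𝓡 n) (ψ y))
      (mfderiv (𝓡 n) (𝓡 n) ψ y (EuclideanSpace.single j (1 : ℝ)) : TangentSpace (𝓡 n) (ψ y))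

/-- The square root of `|det (g_ij)|` in the parametrization `ψ`. -/
def sqrtDet (ψ : EuclideanSpace ℝ (Fin n) → M) (y : EuclideanSpace ℝ (Fin n)) : ℝ :=
  Real.sqrt |(metricMatrix ψ y).det|

/-- The Laplace-Beltrami operator `Δ = - div grad`, computed in the preferred chart at `p`:
`Δ f = - (√det g)⁻¹ ∑ ∂_i (√det g g^{ij} ∂_j f)`. -/
def laplacian (f : M → ℝ) (p : M) : ℝ :=
  let φ := extChartAt (𝓡 n) p;
  -((sqrtDet (n := n) φ.symm (φ p))⁻¹ * ∑ i, ∑ j,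
    fderiv ℝ (fun y => sqrtDet (n := n) φ.symm y * (metricMatrix (n := n) φ.symm y)⁻¹ i j *
      fderiv ℝ (fun z => f (φ.symm z)) y (EuclideanSpace.single j (1 : ℝ)))
      (φ p) (EuclideanSpace.single i (1 : ℝ)))

variable (n M) in
/-- The smooth solutions of `Δ f = λ f` on `M`. -/
def eigenspace (lam : ℝ) : Set (M → ℝ) :=
  {f | ContMDiff (𝓡 n) 𝓘(ℝ, ℝ) ∞ f ∧ ∀ x, laplacian (n := n) f x = lam * f x}

open Classical in
/-- The Riemannian exponential map: `exp_p v = γ(|v|)` for the unit speed geodesic `γ` which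
starts at `p` with velocity `v / |v|`, and `exp_p 0 = p`. (The value `p` is also used where no such
geodesic exists, which does not happen for `v ≠ 0` on a complete Riemannian manifold.) -/
def expMap (p : M) (v : TangentSpace (𝓡 n) p) : M :=
  if h : ∃ γ : ℝ → M, IsGeodesic γ ∧ γ 0 = p ∧
      HasMFDerivAt 𝓘(ℝ, ℝ) (𝓡 n) γ 0
        (ContinuousLinearMap.toSpanSingleton ℝ (‖v‖⁻¹ • v))
  then h.choose ‖v‖ else p

/-- The parametrization `x ↦ exp_p (∑ x_i e_i)` of normal coordinates around `p` given by an
orthonormal basis `e` of the tangent space at `p`. -/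
def normalParam {p : M} (e : OrthonormalBasis (Fin n) ℝ (TangentSpace (𝓡 n) p))
    (x : EuclideanSpace ℝ (Fin n)) : M :=
  expMap p (∑ i, x i • e i)

variable (n M) in
/-- `M` is harmonic: around each point `p`, the density `√|det (g_ij)|` in normal coordinates
depends, on some normal ball, only on the geodesic distance from `p` (which is the Euclidean norm
of the normal coordinates). -/
def IsHarmonic : Prop :=
  ∀ (p : M) (e : OrthonormalBasis (Fin n) ℝ (TangentSpace (𝓡 n) p)), ∃ ε > 0,
    ∀ x y : EuclideanSpace ℝ (Fin n), ‖x‖ < ε → ‖x‖ = ‖y‖ →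
      sqrtDet (normalParam e) x = sqrtDet (normalParam e) y

variable (n) in
/-- An orthonormal basis of the tangent space at `p`. -/
def orthonormalFrame (p : M) : OrthonormalBasis (Fin n) ℝ (TangentSpace (𝓡 n) p) :=
  haveI : FiniteDimensional ℝ (TangentSpace (𝓡 n) p) :=
    inferInstanceAs (FiniteDimensional ℝ (EuclideanSpace ℝ (Fin n)))
  (stdOrthonormalBasis ℝ (TangentSpace (𝓡 n) p)).reindex
    (finCongr (finrank_euclideanSpace_fin (𝕜 := ℝ) (n := n)))

variable (n) in
/-- The average of `f` around `p`: its value at `q` is the mean of `f` over the geodesic sphere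
around `p` through `q`, that is, of `u ↦ f (exp_p (r u))` over the unit sphere of the tangent space
at `p`, with `r = dist p q`. (As the density of a harmonic manifold is radial, this is also
the mean of `f` for the induced measure of the geodesic sphere.) -/
def sphericalMean (p : M) (f : M → ℝ) (q : M) : ℝ :=
  ⨍ u : Metric.sphere (0 : EuclideanSpace ℝ (Fin n)) 1,
    f (normalParam (orthonormalFrame n p) (dist p q • (u : EuclideanSpace ℝ (Fin n))))
    ∂((volume : Measure (EuclideanSpace ℝ (Fin n))).toSphere)

end Riemannian

section Kernel

variable {M : Type*} [MetricSpace M]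

/-- The function `f_p = cosh r + c`, where `r` is the distance from `p`. -/
def coshDist (c : ℝ) (p : M) : M → ℝ := fun q => Real.cosh (dist p q) + c

variable (M) in
/-- `λ` is an eigenvalue of the Laplacian, and all the averaged eigenfunctions corresponding to `λ`
(they are again solutions of `Δ φ = λ φ`) are of the form `cosh r + c`, up to a constant multiple,
where `r` is the distance from the point of averaging. -/
structure HasCoshAverages (n : ℕ) [ChartedSpace (EuclideanSpace ℝ (Fin n)) M]
    [RiemannianBundle (fun x : M => TangentSpace (𝓡 n) x)] (lam c : ℝ) : Prop where
  isEigenvalue : ∃ f ∈ eigenspace n M lam, f ≠ 0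
  mean_mem : ∀ f ∈ eigenspace n M lam, ∀ p : M, sphericalMean n p f ∈ eigenspace n M lam
  mean_eq : ∀ f ∈ eigenspace n M lam, ∀ p : M, ∃ a : ℝ, sphericalMean n p f = a • coshDist c p

variable (M) in
/-- The space `V_λ` spanned by the radial eigenfunctions `f_p = cosh r + c`, `p ∈ M`. -/
def radialSpan (c : ℝ) : Submodule ℝ (M → ℝ) :=
  Submodule.span ℝ (range (coshDist c))

/-- `f_p` as an element of `V_λ`. -/
def radialVec (c : ℝ) (p : M) : radialSpan M c :=
  ⟨coshDist c p, Submodule.subset_span ⟨p, rfl⟩⟩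

theorem span_radialVec (c : ℝ) : Submodule.span ℝ (range (radialVec (M := M) c)) = ⊤ := by
  have h : range (radialVec (M := M) c) = Subtype.val ⁻¹' (range (coshDist (M := M) c)) := by
    ext x
    simp [radialVec, Subtype.ext_iff]
  rw [h]
  exact Submodule.span_span_coe_preimage

/-- There is exactly one bilinear form on `V_λ` with `B (f_p, h) = h p`. -/
theorem existsUnique_form (M : Type*) [MetricSpace M] (c : ℝ) :
    ∃! B : LinearMap.BilinForm ℝ (radialSpan M c),
      ∀ (p : M) (h : radialSpan M c), B (radialVec c p) h = (h : M → ℝ) p := by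
  let T : (M →₀ ℝ) →ₗ[ℝ] radialSpan M c := Finsupp.linearCombination ℝ (radialVec c)
  let ev : M → (radialSpan M c →ₗ[ℝ] ℝ) := fun p =>
    (LinearMap.proj (R := ℝ) (φ := fun _ : M => ℝ) p).comp (radialSpan M c).subtype
  let P : (M →₀ ℝ) →ₗ[ℝ] (radialSpan M c →ₗ[ℝ] ℝ) := Finsupp.linearCombination ℝ ev
  have hT : LinearMap.range T = ⊤ := by
    rw [Finsupp.range_linearCombination, span_radialVec]
  have hker : ∀ a : M →₀ ℝ, T a = 0 → P a = 0 := by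
    intro a ha
    refine LinearMap.ext_on_range (span_radialVec c) fun q => ?_
    have h0 : ((T a : radialSpan M c) : M → ℝ) q = 0 := by rw [ha]; rfl
    have h1 : ((T a : radialSpan M c) : M → ℝ) q = P a (radialVec c q) := by
      simp [T, P, ev, Finsupp.linearCombination_apply, Finsupp.sum, radialVec, coshDist,
        dist_comm q]
    rw [← h1, h0]; rfl
  obtain ⟨s, hs⟩ := T.exists_rightInverse_of_surjective hT
  have hsT : ∀ a, P (s (T a)) = P a := by
    intro a
    rw [← sub_eq_zero, ← map_sub]
    refine hker _ ?_
    have := LinearMap.congr_fun hs (T a)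
    simp only [LinearMap.comp_apply, LinearMap.id_apply] at this
    rw [map_sub, this, sub_self]
  refine ⟨P.comp s, fun p h => ?_, fun B' hB' => ?_⟩
  · have hp : T (Finsupp.single p 1) = radialVec c p := by simp [T]
    rw [← hp, LinearMap.comp_apply, hsT]
    simp [P, ev]
  · refine LinearMap.ext_on_range (span_radialVec c) fun p => LinearMap.ext fun h => ?_
    have hp : T (Finsupp.single p 1) = radialVec c p := by simp [T]
    rw [hB', ← hp, LinearMap.comp_apply, hsT]
    simp [P, ev]

variable (M) in
/-- The bilinear form `B` on `V_λ`, with `B (f_p, ∑ a_q f_q) = ∑ a_q f_q (p)`. -/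
def form (c : ℝ) : LinearMap.BilinForm ℝ (radialSpan M c) :=
  (existsUnique_form M c).choose

theorem form_radialVec (c : ℝ) (p : M) (h : radialSpan M c) :
    form M c (radialVec c p) h = (h : M → ℝ) p :=
  (existsUnique_form M c).choose_spec.1 p h

/-- The subspace `V_γ` of `V_λ` generated by the functions `f_{γ(t)}`, `t ∈ ℝ`. -/
def curveSpan (c : ℝ) (γ : ℝ → M) : Submodule ℝ (radialSpan M c) :=
  Submodule.span ℝ (range fun t : ℝ => radialVec c (γ t))

end Kernel

end HarmonicSpace

end

/-! On an isometric piece of `γ` one has B(f_{γ(s)}, f_{γ(s')}) = cosh s cosh s' - sinh s sinh s' +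
c. This is the form diag(1, -1, c) evaluated on the vectors (cosh s, sinh s, 1). It is nondegenerate
for c ≠ 0, and three distinct nodes give independent vectors. If V_γ is 3-dimensional, the three
corresponding functions are therefore a basis, and B is nondegenerate on V_γ.

Since h(γ(s)) = B(f_{γ(s)}, h), every h in V_λ is locally a combination of cosh, sinh and 1 along
`γ`, hence globally by analyticity (`exists_eq_cosh`). Taking h = f_{γ(s)} shows that `γ` is
globally minimizing.

Now let two geodesics γ₁, γ₂ meet at p at time 0. The function t ↦ cosh d(γ₁(s), γ₂(t)) + cosh
d(γ₁(-s), γ₂(t)) is a combination of cosh, sinh and 1, and by the triangle inequality it is minimal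
at t = 0. Its sinh coefficient vanishes, so it is even. Exchanging the two geodesics and adding
gives d(γ₁(-s), γ₂(-t)) = d(γ₁(s), γ₂(t)) (`dist_neg_neg`), so the geodesic reflection at p is a
well-defined isometry.

It remains to join any two points by a geodesic defined on all of ℝ, with geodesics understood
metrically. A locally compact length space has points strictly between any two given ones. Segments
can be prolonged because f_p is a nonzero multiple of an averaged eigenfunction: it is smooth, so
d(p, ·) is differentiable away from p and grows with slope one in the direction opposite to a
segment towards p. Zorn's lemma then produces rays, and two overlapping rays form a geodesic. -/

namespace HarmonicSpace

/-! ### Metric geometry: segments, rays and complete geodesics. -/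

section Metric

open Filter Topology

variable {M : Type*} [MetricSpace M]

/-- In a locally compact length space, all points at a small distance from `x` can be chosen
exactly between `x` and a given point. -/
theorem eventually_exists_dist_eq [LocallyCompactSpace M]
    (hlen : ∀ x y : M, ∀ s, 0 < s → s < dist x y → ∀ ε > 0,
      ∃ z, dist x z = s ∧ dist z y < dist x y - s + ε) (x : M) :
    ∀ᶠ s in 𝓝[>] (0 : ℝ), ∀ y, s < dist x y → ∃ z, dist x z = s ∧ dist z y = dist x y - s := by
  obtain ⟨ρ, hρ, hK⟩ := Metric.exists_isCompact_closedBall x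
  filter_upwards [Ioo_mem_nhdsGT hρ] with s hs y hy
  have hS : IsCompact (Metric.sphere x s) :=
    hK.of_isClosed_subset Metric.isClosed_sphere
      (Metric.sphere_subset_closedBall.trans (Metric.closedBall_subset_closedBall hs.2.le))
  obtain ⟨z₀, hz₀, -⟩ := hlen x y s hs.1 hy 1 one_pos
  -- The point of the compact sphere closest to `y` turns the approximate betweenness into an exact
  -- one.
  obtain ⟨z, hz, hmin⟩ := hS.exists_isMinOn ⟨z₀, by simpa [dist_comm] using hz₀⟩
    (f := fun z => dist z y) (by fun_prop)
  have hz' : dist x z = s := by simpa [dist_comm] using hz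
  refine ⟨z, hz', le_antisymm (le_of_forall_pos_lt_add fun ε hε => ?_) ?_⟩
  · obtain ⟨w, hw, hwy⟩ := hlen x y s hs.1 hy ε hε
    exact (hmin (show w ∈ Metric.sphere x s by simpa [dist_comm] using hw)).trans_lt hwy
  · linarith [dist_triangle x z y]

theorem exists_dist_add_dist_eq [LocallyCompactSpace M]
    (hlen : ∀ x y : M, ∀ s, 0 < s → s < dist x y → ∀ ε > 0,
      ∃ z, dist x z = s ∧ dist z y < dist x y - s + ε) {x y : M} (hxy : x ≠ y) :
    ∃ z, 0 < dist x z ∧ 0 < dist z y ∧ dist x z + dist z y = dist x y := by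
  obtain ⟨s, hs, hs'⟩ := ((eventually_exists_dist_eq hlen x).and
    (Ioo_mem_nhdsGT (dist_pos.2 hxy))).exists
  obtain ⟨z, hz, hzy⟩ := hs y hs'.2
  exact ⟨z, by linarith [hs'.1], by linarith [hs'.2], by linarith⟩

/-- If the distance from `p` has upper slope at least one away from `p`, then every segment
starting at `p` can be prolonged. -/
theorem exists_dist_eq_add_of_slope [LocallyCompactSpace M] {p x : M} (hx : x ≠ p)
    (hslope : ∀ x ≠ p, ∀ κ < (1 : ℝ), ∃ᶠ w in 𝓝 x, κ * dist x w < dist p w - dist p x) :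
    ∃ y ≠ x, dist p y = dist p x + dist x y := by
  obtain ⟨ρ₀, hρ₀, hK₀⟩ := Metric.exists_isCompact_closedBall x
  obtain ⟨ρ, hρ, hρ'⟩ := exists_between (lt_min hρ₀ (dist_pos.2 hx))
  have hK : IsCompact (Metric.closedBall x ρ) :=
    hK₀.of_isClosed_subset Metric.isClosed_closedBall
      (Metric.closedBall_subset_closedBall (hρ'.trans_le (min_le_left _ _)).le)
  -- A maximum of d(p, ·) - κ d(x, ·) on the ball cannot be interior, since the slope condition
  -- would increase it. It lies on the sphere, where d(p, ·) has grown by at least κρ. Letting κ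
  -- tend to 1 gives exact growth.
  have key : ∀ κ < (1 : ℝ), 0 ≤ κ → ∃ y ∈ Metric.sphere x ρ, dist p x + κ * ρ ≤ dist p y := by
    intro κ hκ hκ0
    obtain ⟨y, hy, hmax⟩ := hK.exists_isMaxOn ⟨x, Metric.mem_closedBall_self hρ.le⟩
      (f := fun y => dist p y - κ * dist x y) (by fun_prop)
    have h0 : dist p x ≤ dist p y - κ * dist x y := by
      simpa using hmax (Metric.mem_closedBall_self hρ.le)
    have hyp : y ≠ p := by
      rintro rfl
      have := mul_nonneg hκ0 (dist_nonneg (x := x) (y := y))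
      have h2 := dist_pos.2 hx
      rw [dist_self, dist_comm y x] at h0
      linarith
    rcases (Metric.mem_closedBall.1 hy).lt_or_eq with h | h
    · exfalso
      obtain ⟨w, hw, hwb⟩ := ((hslope y hyp κ hκ).and_eventually
        (Metric.isOpen_ball.mem_nhds (Metric.mem_ball.2 h))).exists
      have h1 : dist p w - κ * dist x w ≤ dist p y - κ * dist x y :=
        hmax (Metric.ball_subset_closedBall hwb)
      have h2 : κ * dist x w ≤ κ * (dist x y + dist y w) :=
        mul_le_mul_of_nonneg_left (dist_triangle x y w) hκ0
      linarith
    · refine ⟨y, h, ?_⟩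
      rw [dist_comm] at h
      rw [h] at h0
      linarith
  obtain ⟨y₀, hy₀, -⟩ := key 0 one_pos le_rfl
  obtain ⟨y, hy, hmax⟩ := (hK.of_isClosed_subset Metric.isClosed_sphere
    Metric.sphere_subset_closedBall).exists_isMaxOn ⟨y₀, hy₀⟩ (f := fun y => dist p y)
    (by fun_prop)
  have hxy : dist x y = ρ := by simpa [dist_comm] using hy
  refine ⟨y, fun h => by simp [h] at hxy; linarith, ?_⟩
  refine le_antisymm (dist_triangle _ _ _) (le_of_forall_pos_le_add fun ε hε => ?_)
  have hmin : 0 < min ε ρ := lt_min hε hρ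
  -- This κ lies in [0, 1) and satisfies κρ = ρ - min ε ρ, so the loss is at most ε.
  obtain ⟨z, hz, hpz⟩ := key (1 - min ε ρ / ρ) (by linarith [div_pos hmin hρ])
    (by linarith [(div_le_one hρ).2 (min_le_right ε ρ)])
  have h1 : dist p z ≤ dist p y := hmax hz
  have h2 : (1 - min ε ρ / ρ) * ρ = ρ - min ε ρ := by field_simp
  rw [hxy]
  linarith [min_le_left ε ρ]

/-- A set on which the distance is the difference of the distances from `p`. -/
def IsRadial (p : M) (C : Set M) : Prop :=
  ∀ x ∈ C, ∀ y ∈ C, dist x y = |dist p x - dist p y|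

theorem IsRadial.insert {p z : M} {C : Set M} (hC : IsRadial p C)
    (hz : ∀ x ∈ C, dist x z = |dist p x - dist p z|) : IsRadial p (insert z C) := by
  rintro x (rfl | hx) y (rfl | hy)
  · simp
  · rw [dist_comm, hz y hy, abs_sub_comm]
  · exact hz x hx
  · exact hC x hx y hy

theorem IsRadial.exists_maximal {p : M} {C : Set M} (hC : IsRadial p C) :
    ∃ D, C ⊆ D ∧ Maximal (IsRadial p) D := by
  obtain ⟨D, hD, hmax⟩ := zorn_subset_nonempty {D : Set M | IsRadial p D} (fun c hc hchain hne => by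
    refine ⟨⋃₀ c, fun x hx y hy => ?_, fun s hs => subset_sUnion_of_mem hs⟩
    obtain ⟨s, hs, hxs⟩ := hx
    obtain ⟨t, ht, hyt⟩ := hy
    rcases hchain.total hs ht with h | h
    · exact hc ht x (h hxs) y hyt
    · exact hc hs x hxs y (h hyt)) C hC
  exact ⟨D, hD, hmax⟩

theorem mem_of_maximal_isRadial {p z : M} {D : Set M} (hD : Maximal (IsRadial p) D)
    (hz : ∀ x ∈ D, dist x z = |dist p x - dist p z|) : z ∈ D :=
  hD.2 (hD.1.insert hz) (subset_insert z D) (mem_insert z D)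

/-- Maximality makes `D` the intersection of closed conditions, hence complete, and the distance
from `p` embeds it isometrically in ℝ. -/
theorem isClosed_image_dist_of_maximal_isRadial [CompleteSpace M] {p : M} {D : Set M}
    (hD : Maximal (IsRadial p) D) : IsClosed (dist p '' D) := by
  have hcl : IsClosed D := by
    have : D = ⋂ x ∈ D, {z | dist x z = |dist p x - dist p z|} := by
      ext z
      simp only [mem_iInter, mem_ofPred_eq]
      exact ⟨fun hz x hx => hD.1 x hx z hz, mem_of_maximal_isRadial hD⟩
    rw [this]
    exact isClosed_biInter fun x _ => isClosed_eq (by fun_prop) (by fun_prop)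
  have hiso : Isometry (fun x : D => dist p (x : M)) := by
    refine Isometry.of_dist_eq fun x y => ?_
    rw [Real.dist_eq, Subtype.dist_eq, hD.1 x x.2 y y.2]
  have : CompleteSpace D := hcl.completeSpace_coe
  have h := hiso.isClosedEmbedding.isClosed_range
  rwa [show range (fun x : D => dist p (x : M)) = dist p '' D by
    ext s; simp] at h

/-- Used to fill gaps: `z` lies beyond `x` as seen from `p`, and each point of `D` is either no
farther from `p` than `x` or lies beyond `z` in line with it. -/
theorem mem_of_maximal_isRadial_of_le_or {p x z : M} {D : Set M} (hD : Maximal (IsRadial p) D)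
    (hx : x ∈ D) (hz : dist p z = dist p x + dist x z)
    (hw : ∀ w ∈ D, dist p w ≤ dist p x ∨ dist w z = dist p w - dist p z) : z ∈ D := by
  refine mem_of_maximal_isRadial hD fun w hwD => ?_
  rcases hw w hwD with h | h
  · have h2 := hD.1 w hwD x hx
    rw [abs_of_nonpos (by linarith)] at h2
    rw [abs_of_nonpos (by linarith [dist_nonneg (x := x) (y := z)])]
    linarith [dist_triangle w x z, dist_triangle p w z]
  · rw [h, abs_of_nonneg]
    rw [← h]
    exact dist_nonneg

/-- Maximal radial sets are rays. -/
theorem image_dist_of_maximal_isRadial [CompleteSpace M] {p : M} {D : Set M}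
    (hbetween : ∀ x y : M, x ≠ y → ∃ z, 0 < dist x z ∧ 0 < dist z y ∧
      dist x z + dist z y = dist x y)
    (hext : ∀ x, ∃ y ≠ x, dist p y = dist p x + dist x y)
    (hD : Maximal (IsRadial p) D) : dist p '' D = Ici 0 := by
  have hcl := isClosed_image_dist_of_maximal_isRadial hD
  refine Subset.antisymm (by rintro _ ⟨x, -, rfl⟩; exact dist_nonneg) fun s hs => ?_
  by_contra hsD
  have hp : p ∈ D := mem_of_maximal_isRadial hD fun x _ => by
    rw [dist_self, sub_zero, abs_of_nonneg dist_nonneg, dist_comm]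
  -- Suppose the value `s` is missed, and let `x` be the last point of `D` before it. If `D` also
  -- has a first point `y` after `s`, any point between `x` and `y` can be added. Otherwise a
  -- prolongation beyond `x` can be added. Both contradict the choice of `x` and `y`.
  have hA : sSup (dist p '' D ∩ Iic s) ∈ dist p '' D ∩ Iic s :=
    (hcl.inter isClosed_Iic).csSup_mem ⟨0, ⟨p, hp, dist_self p⟩, hs⟩ ⟨s, fun _ h => h.2⟩
  have hA' : ∀ w ∈ D, dist p w ≤ s → dist p w ≤ sSup (dist p '' D ∩ Iic s) := fun w hw h =>
    le_csSup ⟨s, fun _ h => h.2⟩ ⟨⟨w, hw, rfl⟩, h⟩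
  obtain ⟨⟨x, hx, hxa⟩, hxs⟩ := hA
  rw [← hxa] at hA' hxs
  have hxs' : dist p x < s := lt_of_le_of_ne hxs fun h => hsD ⟨x, hx, h⟩
  by_cases hB : ∃ w ∈ D, s < dist p w
  · obtain ⟨w₀, hw₀, hsw₀⟩ := hB
    have hB : sInf (dist p '' D ∩ Ici s) ∈ dist p '' D ∩ Ici s :=
      (hcl.inter isClosed_Ici).csInf_mem ⟨_, ⟨w₀, hw₀, rfl⟩, hsw₀.le⟩ ⟨s, fun _ h => h.2⟩
    have hB' : ∀ w ∈ D, s < dist p w → sInf (dist p '' D ∩ Ici s) ≤ dist p w := fun w hw h =>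
      csInf_le ⟨s, fun _ h => h.2⟩ ⟨⟨w, hw, rfl⟩, h.le⟩
    obtain ⟨⟨y, hy, hyb⟩, hys⟩ := hB
    rw [← hyb] at hB' hys
    have hys' : s < dist p y := lt_of_le_of_ne hys fun h => hsD ⟨y, hy, h.symm⟩
    have hxy := hD.1 x hx y hy
    rw [abs_of_nonpos (by linarith)] at hxy
    obtain ⟨z, hxz, hzy, hsum⟩ := hbetween x y fun h => by rw [h] at hxs'; linarith
    have hz : dist p z = dist p x + dist x z := by
      linarith [dist_triangle p x z, dist_triangle p z y]
    have hzD : z ∈ D := by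
      refine mem_of_maximal_isRadial_of_le_or hD hx hz fun w hw => ?_
      rcases le_or_gt (dist p w) s with h | h
      · exact Or.inl (hA' w hw h)
      · have h1 := hB' w hw h
        have h2 := hD.1 w hw y hy
        rw [abs_of_nonneg (by linarith)] at h2
        right
        linarith [dist_triangle w y z, dist_triangle p z w, dist_comm y z, dist_comm w z]
    rcases lt_or_ge s (dist p z) with h | h
    · linarith [hB' z hzD h]
    · linarith [hA' z hzD h]
  · push Not at hB
    obtain ⟨y, hyx, hy⟩ := hext x
    have hyD : y ∈ D :=
      mem_of_maximal_isRadial_of_le_or hD hx hy fun w hw => Or.inl (hA' w hw (hB w hw))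
    linarith [hA' y hyD (hB y hyD), dist_pos.2 hyx.symm]

/-- A radial set is contained in an isometric ray. -/
theorem IsRadial.exists_ray [CompleteSpace M] {p : M} {C : Set M} (hC : IsRadial p C)
    (hbetween : ∀ x y : M, x ≠ y → ∃ z, 0 < dist x z ∧ 0 < dist z y ∧
      dist x z + dist z y = dist x y)
    (hext : ∀ x, ∃ y ≠ x, dist p y = dist p x + dist x y) :
    ∃ ρ : ℝ → M, (∀ s t, 0 ≤ s → 0 ≤ t → dist (ρ s) (ρ t) = |s - t|) ∧
      ∀ x ∈ C, ρ (dist p x) = x := by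
  obtain ⟨D, hCD, hD⟩ := hC.exists_maximal
  have him := image_dist_of_maximal_isRadial hbetween hext hD
  have h : ∀ s : ℝ, ∃ x, 0 ≤ s → x ∈ D ∧ dist p x = s := fun s => by
    rcases le_or_gt 0 s with hs | hs
    · obtain ⟨x, hx, hxs⟩ := him.symm.subset (mem_Ici.2 hs)
      exact ⟨x, fun _ => ⟨hx, hxs⟩⟩
    · exact ⟨p, fun h => absurd h (not_le.2 hs)⟩
  choose ρ hρ using h
  refine ⟨ρ, fun s t hs ht => ?_, fun x hx => ?_⟩
  · rw [hD.1 _ (hρ s hs).1 _ (hρ t ht).1, (hρ s hs).2, (hρ t ht).2]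
  · have h := hρ (dist p x) dist_nonneg
    rw [← dist_eq_zero, hD.1 _ h.1 _ (hCD hx), h.2, sub_self, abs_zero]

/-- If segments can be subdivided and prolonged, then any two points lie on a geodesic. -/
theorem exists_isGeodesic [CompleteSpace M]
    (hbetween : ∀ x y : M, x ≠ y → ∃ z, 0 < dist x z ∧ 0 < dist z y ∧
      dist x z + dist z y = dist x y)
    (hext : ∀ p x : M, ∃ y ≠ x, dist p y = dist p x + dist x y) (p q : M) :
    ∃ γ : ℝ → M, IsGeodesic γ ∧ γ 0 = p ∧ γ (dist p q) = q := by
  have hC : IsRadial p {p, q} := by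
    rintro x (rfl | rfl) y (rfl | rfl) <;> simp [dist_comm]
  obtain ⟨ρ, hρ, hρC⟩ := hC.exists_ray hbetween (hext p)
  have hρ0 : ρ 0 = p := by simpa using hρC p (by simp)
  -- Seen from `ρ 1`, the initial segment of the ray is again radial, and a ray containing it runs
  -- on backwards beyond `p`. The two rays overlap in a segment of length one, so every parameter
  -- has a window of radius 1/2 inside one of them.
  have hC' : IsRadial (ρ 1) (ρ '' Icc 0 1) := by
    rintro _ ⟨s, hs, rfl⟩ _ ⟨t, ht, rfl⟩
    rw [hρ s t hs.1 ht.1, hρ 1 s zero_le_one hs.1, hρ 1 t zero_le_one ht.1,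
      abs_of_nonneg (sub_nonneg.2 hs.2), abs_of_nonneg (sub_nonneg.2 ht.2), abs_sub_comm]
    congr 1
    ring
  obtain ⟨ρ', hρ', hρC'⟩ := hC'.exists_ray hbetween (hext (ρ 1))
  have hglue : ∀ t ∈ Icc (0 : ℝ) 1, ρ' (1 - t) = ρ t := fun t ht => by
    have := hρC' (ρ t) ⟨t, ht, rfl⟩
    rwa [hρ 1 t zero_le_one ht.1, abs_of_nonneg (sub_nonneg.2 ht.2)] at this
  let γ : ℝ → M := fun t => if 0 ≤ t then ρ t else ρ' (1 - t)
  have hγ1 : ∀ t ≤ 1, γ t = ρ' (1 - t) := fun t ht => by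
    by_cases h : 0 ≤ t
    · simp only [γ, h, if_true]
      exact (hglue t ⟨h, ht⟩).symm
    · simp [γ, h]
  have hγ0 : ∀ t, 0 ≤ t → γ t = ρ t := fun t ht => by simp [γ, ht]
  refine ⟨γ, fun t => ⟨1 / 2, by norm_num, fun s hs s' hs' => ?_⟩, by rw [hγ0 0 le_rfl, hρ0],
    by rw [hγ0 _ dist_nonneg, hρC q (by simp)]⟩
  rcases le_or_gt t (1 / 2) with ht | ht
  · rw [hγ1 s (by linarith [hs.2]), hγ1 s' (by linarith [hs'.2]),
      hρ' _ _ (by linarith [hs.2]) (by linarith [hs'.2]), abs_sub_comm]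
    congr 1
    ring
  · rw [hγ0 s (by linarith [hs.1]), hγ0 s' (by linarith [hs'.1]),
      hρ _ _ (by linarith [hs.1]) (by linarith [hs'.1])]

end Metric

/-! ### The bilinear form along a geodesic. -/

section Form

variable {M : Type*} [MetricSpace M] {c : ℝ} {γ : ℝ → M}

theorem form_radialVec_radialVec (c : ℝ) (p q : M) :
    form M c (radialVec c p) (radialVec c q) = Real.cosh (dist p q) + c := by
  rw [form_radialVec, dist_comm]
  rfl

theorem form_comm (c : ℝ) (f h : radialSpan M c) : form M c f h = form M c h f := by
  have : form M c = LinearMap.flip (form M c) := by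
    refine LinearMap.ext_on_range (span_radialVec c) fun p => ?_
    refine LinearMap.ext_on_range (span_radialVec c) fun q => ?_
    rw [form_radialVec_radialVec]
    exact (dist_comm p q ▸ form_radialVec_radialVec c q p).symm
  exact LinearMap.congr_fun (LinearMap.congr_fun this f) h

/-- The vectors `f_{γ(t - h)}`, `f_{γ(t)}`, `f_{γ(t + h)}`. -/
noncomputable def tripleVec (c : ℝ) (γ : ℝ → M) (t h : ℝ) (i : Fin 3) : radialSpan M c :=
  radialVec c (γ (t + ![-h, 0, h] i))

theorem tripleVec_mem (t h : ℝ) (i : Fin 3) : tripleVec c γ t h i ∈ curveSpan c γ :=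
  Submodule.subset_span ⟨_, rfl⟩

/-- On an isometric piece of `γ`, the form separates `f_{γ(t + u)}` from the combinations of the
`f_{γ(t ± h)}` and `f_{γ(t)}` unless the coefficients interpolate `cosh`, `sinh` and `1`. -/
theorem interpolation_of_form_eq_zero (hc : c ≠ 0) {t ε h u : ℝ}
    (hγ : ∀ s ∈ Ioo (-ε) ε, ∀ s' ∈ Ioo (-ε) ε, dist (γ (t + s)) (γ (t + s')) = |s - s'|)
    (hh : 0 < h) (hhε : h < ε) (hu : u ∈ Ioo (-ε) ε) (a : Fin 3 → ℝ) (β : ℝ)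
    (ha : ∀ j, form M c (tripleVec c γ t h j)
      (∑ i, a i • tripleVec c γ t h i - β • radialVec c (γ (t + u))) = 0) :
    (a 0 + a 2) * Real.cosh h + a 1 = β * Real.cosh u ∧
      (a 2 - a 0) * Real.sinh h = β * Real.sinh u ∧ a 0 + a 1 + a 2 = β := by
  have hS : Real.sinh h ≠ 0 := (Real.sinh_pos_iff.2 hh).ne'
  have hC : Real.cosh h - 1 ≠ 0 := (sub_pos.2 (Real.one_lt_cosh.2 hh.ne')).ne'
  have hn : -h ∈ Ioo (-ε) ε := ⟨by linarith, by linarith⟩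
  have h0 : (0 : ℝ) ∈ Ioo (-ε) ε := ⟨by linarith, by linarith⟩
  have hp : h ∈ Ioo (-ε) ε := ⟨by linarith, by linarith⟩
  have e0 := ha 0
  have e1 := ha 1
  have e2 := ha 2
  simp only [tripleVec, Fin.sum_univ_three, map_sub, map_add, map_smul, form_radialVec_radialVec,
    smul_eq_mul, Matrix.cons_val_zero, Matrix.cons_val_one, Matrix.cons_val] at e0 e1 e2
  rw [hγ _ hn _ hn, hγ _ hn _ h0, hγ _ hn _ hp, hγ _ hn _ hu] at e0
  rw [hγ _ h0 _ hn, hγ _ h0 _ h0, hγ _ h0 _ hp, hγ _ h0 _ hu] at e1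
  rw [hγ _ hp _ hn, hγ _ hp _ h0, hγ _ hp _ hp, hγ _ hp _ hu] at e2
  simp only [Real.cosh_abs, Real.cosh_sub, Real.cosh_neg, Real.sinh_neg, Real.cosh_zero,
    Real.sinh_zero] at e0 e1 e2
  -- `P`, `Q`, `R` are the errors in interpolating cosh, sinh and 1. By the addition formula,
  -- pairing with the three nodes gives P cosh s - Q sinh s + cR at s = -h, 0, h.
  set P := (a 0 + a 2) * Real.cosh h + a 1 - β * Real.cosh u with hP
  set Q := (a 2 - a 0) * Real.sinh h - β * Real.sinh u with hQ
  set R := a 0 + a 1 + a 2 - β with hR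
  have f0 : P * Real.cosh h + Q * Real.sinh h + c * R = 0 := by rw [hP, hQ, hR]; linarith
  have f1 : P + c * R = 0 := by rw [hP, hR]; linarith
  have f2 : P * Real.cosh h - Q * Real.sinh h + c * R = 0 := by rw [hP, hQ, hR]; linarith
  have q : Q = 0 := by
    have : Q * Real.sinh h = 0 := by linarith
    exact (mul_eq_zero.1 this).resolve_right hS
  have p : P = 0 := by
    have : P * (Real.cosh h - 1) = 0 := by rw [q] at f0; linarith
    exact (mul_eq_zero.1 this).resolve_right hC
  have r : R = 0 := by
    rw [p, zero_add] at f1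
    exact (mul_eq_zero.1 f1).resolve_left hc
  exact ⟨by linarith, by linarith, by linarith⟩

/-- The case β = 0 of the interpolation identities: the Gram matrix of the three vectors is
invertible. This yields both their independence and the nondegeneracy of the form. -/
theorem coeff_eq_zero_of_form_eq_zero (hc : c ≠ 0) {t ε h : ℝ}
    (hγ : ∀ s ∈ Ioo (-ε) ε, ∀ s' ∈ Ioo (-ε) ε, dist (γ (t + s)) (γ (t + s')) = |s - s'|)
    (hh : 0 < h) (hhε : h < ε) (a : Fin 3 → ℝ)
    (ha : ∀ j, form M c (tripleVec c γ t h j) (∑ i, a i • tripleVec c γ t h i) = 0) : a = 0 := by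
  obtain ⟨e1, e2, e3⟩ := interpolation_of_form_eq_zero hc hγ hh hhε (u := h)
    ⟨by linarith, hhε⟩ a 0 (by simpa using ha)
  have hS : Real.sinh h ≠ 0 := (Real.sinh_pos_iff.2 hh).ne'
  have hC : Real.cosh h - 1 ≠ 0 := (sub_pos.2 (Real.one_lt_cosh.2 hh.ne')).ne'
  have h1 : a 2 - a 0 = 0 := by simpa [hS] using e2
  have h2 : (a 0 + a 2) * (Real.cosh h - 1) = 0 := by linarith
  have h3 := (mul_eq_zero.1 h2).resolve_right hC
  funext i
  fin_cases i <;> simp <;> linarith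

theorem span_tripleVec (hc : c ≠ 0) {t ε h : ℝ}
    (hγ : ∀ s ∈ Ioo (-ε) ε, ∀ s' ∈ Ioo (-ε) ε, dist (γ (t + s)) (γ (t + s')) = |s - s'|)
    (hh : 0 < h) (hhε : h < ε) (h3 : Module.finrank ℝ (curveSpan c γ) = 3) :
    Submodule.span ℝ (range (tripleVec c γ t h)) = curveSpan c γ := by
  have hli : LinearIndependent ℝ (tripleVec c γ t h) := by
    rw [Fintype.linearIndependent_iff]
    intro a ha i
    exact congrFun (coeff_eq_zero_of_form_eq_zero hc hγ hh hhε a (by simp [ha])) i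
  have : FiniteDimensional ℝ (curveSpan c γ) := FiniteDimensional.of_finrank_pos (by omega)
  refine Submodule.eq_of_le_of_finrank_eq (Submodule.span_le.2 ?_) ?_
  · rintro _ ⟨i, rfl⟩
    exact tripleVec_mem t h i
  · rw [finrank_span_eq_card hli, h3, Fintype.card_fin]

theorem IsGeodesic.exists_isometric (hγ : IsGeodesic γ) (t : ℝ) : ∃ ε > 0,
    ∀ s ∈ Ioo (-ε) ε, ∀ s' ∈ Ioo (-ε) ε, dist (γ (t + s)) (γ (t + s')) = |s - s'| := by
  obtain ⟨ε, hε, h⟩ := hγ t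
  refine ⟨ε, hε, fun s hs s' hs' => ?_⟩
  rw [h (t + s) ⟨by linarith [hs.1], by linarith [hs.2]⟩ (t + s')
    ⟨by linarith [hs'.1], by linarith [hs'.2]⟩, add_sub_add_left_eq_sub]

theorem nondegenerate_restrict_curveSpan (hc : c ≠ 0) (hγ : IsGeodesic γ)
    (h3 : Module.finrank ℝ (curveSpan c γ) = 3) :
    ((form M c).restrict (curveSpan c γ)).Nondegenerate := by
  obtain ⟨ε, hε, hiso⟩ := hγ.exists_isometric 0
  have hspan := span_tripleVec hc hiso (half_pos hε) (half_lt_self hε) h3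
  have key : ∀ x ∈ curveSpan c γ, (∀ y ∈ curveSpan c γ, form M c y x = 0) → x = 0 := by
    intro x hx h
    rw [← hspan] at hx
    obtain ⟨a, rfl⟩ := (Submodule.mem_span_range_iff_exists_fun ℝ).1 hx
    rw [coeff_eq_zero_of_form_eq_zero hc hiso (half_pos hε) (half_lt_self hε) a
      fun j => h _ (tripleVec_mem _ _ j)]
    simp
  refine ⟨fun x hx => ?_, fun x hx => ?_⟩
  · exact Subtype.ext (key x x.2 fun y hy => by rw [form_comm]; exact hx ⟨y, hy⟩)
  · exact Subtype.ext (key x x.2 fun y hy => hx ⟨y, hy⟩)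

/-- Evaluation at γ(s) is pairing with f_{γ(s)}, which is a combination of three fixed vectors whose
coefficients interpolate cosh, sinh and 1 exactly. -/
theorem exists_eq_cosh_near (hc : c ≠ 0) (hγ : IsGeodesic γ)
    (h3 : Module.finrank ℝ (curveSpan c γ) = 3) (f : radialSpan M c) (t : ℝ) :
    ∃ a b e : ℝ, ∀ᶠ s in nhds t, (f : M → ℝ) (γ s) = a * Real.cosh s + b * Real.sinh s + e := by
  obtain ⟨ε, hε, hiso⟩ := hγ.exists_isometric t
  obtain ⟨h, hh, hhε⟩ := exists_between hε
  have hS : Real.sinh h ≠ 0 := (Real.sinh_pos_iff.2 hh).ne'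
  have hC : Real.cosh h - 1 ≠ 0 := (sub_pos.2 (Real.one_lt_cosh.2 hh.ne')).ne'
  have hspan := span_tripleVec hc hiso hh hhε h3
  let y : Fin 3 → ℝ := fun i => form M c (tripleVec c γ t h i) f
  obtain ⟨A, hA⟩ : ∃ A, A * (Real.cosh h - 1) = (y 0 + y 2) / 2 - y 1 :=
    ⟨_, div_mul_cancel₀ _ hC⟩
  obtain ⟨B, hB⟩ : ∃ B, B * Real.sinh h = (y 2 - y 0) / 2 := ⟨_, div_mul_cancel₀ _ hS⟩
  -- The function A cosh(s - t) + B sinh(s - t) + (y₁ - A) takes the values yᵢ at the three nodes;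
  -- these are its coefficients after expansion.
  refine ⟨A * Real.cosh t - B * Real.sinh t, B * Real.cosh t - A * Real.sinh t, y 1 - A, ?_⟩
  filter_upwards [Ioo_mem_nhds (sub_lt_self t hε) (lt_add_of_pos_right t hε)] with s hs
  have hu : s - t ∈ Ioo (-ε) ε := ⟨by linarith [hs.1], by linarith [hs.2]⟩
  have hmem : radialVec c (γ s) ∈ Submodule.span ℝ (range (tripleVec c γ t h)) := by
    rw [hspan]
    exact Submodule.subset_span ⟨s, rfl⟩
  obtain ⟨a, ha⟩ := (Submodule.mem_span_range_iff_exists_fun ℝ).1 hmem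
  obtain ⟨e1, e2, e3⟩ := interpolation_of_form_eq_zero hc hiso hh hhε hu a 1 fun j => by
    rw [add_sub_cancel, ha, one_smul, sub_self, map_zero]
  have hf : (f : M → ℝ) (γ s) = a 0 * y 0 + a 1 * y 1 + a 2 * y 2 := by
    rw [← form_radialVec, ← ha, Fin.sum_univ_three]
    simp [y]
  rw [one_mul, Real.cosh_sub] at e1
  rw [one_mul, Real.sinh_sub] at e2
  have hy0 : y 0 = A * Real.cosh h - B * Real.sinh h + (y 1 - A) := by linarith
  have hy2 : y 2 = A * Real.cosh h + B * Real.sinh h + (y 1 - A) := by linarith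
  rw [hf]
  linear_combination a 0 * hy0 + a 2 * hy2 + A * e1 + B * e2 + (y 1 - A) * e3

theorem analyticOnNhd_cosh_sinh (a b e : ℝ) :
    AnalyticOnNhd ℝ (fun s => a * Real.cosh s + b * Real.sinh s + e) univ := fun _ _ =>
  ((analyticAt_const.mul Real.analyticAt_cosh).add
    (analyticAt_const.mul Real.analyticAt_sinh)).add analyticAt_const

/-- The elements of `V_λ` restrict to combinations of `cosh`, `sinh` and `1` on a geodesic `γ` with
three-dimensional `V_γ`. -/
theorem exists_eq_cosh (hc : c ≠ 0) (hγ : IsGeodesic γ)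
    (h3 : Module.finrank ℝ (curveSpan c γ) = 3) (f : radialSpan M c) :
    ∃ a b e : ℝ, ∀ s, (f : M → ℝ) (γ s) = a * Real.cosh s + b * Real.sinh s + e := by
  obtain ⟨a, b, e, h⟩ := exists_eq_cosh_near hc hγ h3 f 0
  -- The local coefficients may a priori depend on the point, but they make f ∘ γ analytic, and the
  -- identity theorem fixes them.
  have hf : AnalyticOnNhd ℝ (fun s => (f : M → ℝ) (γ s)) univ := by
    intro s _
    obtain ⟨a, b, e, h⟩ := exists_eq_cosh_near hc hγ h3 f s
    exact (analyticOnNhd_cosh_sinh a b e s trivial).congr (h.mono fun _ h => h.symm)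
  exact ⟨a, b, e, congrFun (hf.eq_of_eventuallyEq (analyticOnNhd_cosh_sinh a b e) h)⟩

theorem exists_cosh_dist_eq (hc : c ≠ 0) (hγ : IsGeodesic γ)
    (h3 : Module.finrank ℝ (curveSpan c γ) = 3) (q : M) :
    ∃ a b e : ℝ, ∀ s, Real.cosh (dist q (γ s)) = a * Real.cosh s + b * Real.sinh s + e := by
  obtain ⟨a, b, e, h⟩ := exists_eq_cosh hc hγ h3 (radialVec c q)
  refine ⟨a, b, e - c, fun s => ?_⟩
  have := h s
  change Real.cosh (dist q (γ s)) + c = _ at this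
  linarith

/-- A geodesic `γ` with three-dimensional `V_γ` minimizes the distance between its points. -/
theorem dist_eq_of_finrank_eq_three (hc : c ≠ 0) (hγ : IsGeodesic γ)
    (h3 : Module.finrank ℝ (curveSpan c γ) = 3) (s t : ℝ) : dist (γ s) (γ t) = |s - t| := by
  obtain ⟨a, b, e, h⟩ := exists_cosh_dist_eq hc hγ h3 (γ s)
  obtain ⟨ε, hε, hiso⟩ := hγ s
  have hnear : (fun t => a * Real.cosh t + b * Real.sinh t + e) =ᶠ[nhds s]
      (fun t => Real.cosh s * Real.cosh t + -Real.sinh s * Real.sinh t + 0) := by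
    filter_upwards [Ioo_mem_nhds (sub_lt_self s hε) (lt_add_of_pos_right s hε)] with t ht
    rw [← h t, hiso s ⟨by linarith, by linarith⟩ t ht, Real.cosh_abs, Real.cosh_sub]
    ring
  have hall := congrFun ((analyticOnNhd_cosh_sinh _ _ _).eq_of_eventuallyEq (analyticOnNhd_cosh_sinh _ _ _) hnear) t
  have hcosh : Real.cosh (dist (γ s) (γ t)) = Real.cosh |s - t| := by
    rw [h t, hall, Real.cosh_abs, Real.cosh_sub]
    ring
  exact Real.cosh_injOn (mem_Ici.2 dist_nonneg) (mem_Ici.2 (abs_nonneg _)) hcosh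

end Form

/-! ### The geodesic reflection is an isometry. -/

section Symmetry

variable {M : Type*} [MetricSpace M] {p : M} {γ₁ γ₂ : ℝ → M}

theorem cosh_dist_add_cosh_dist_neg (h₁ : ∀ s t, dist (γ₁ s) (γ₁ t) = |s - t|)
    (h0 : γ₁ 0 = γ₂ 0)
    (h : ∀ q : M, ∃ a b e : ℝ, ∀ t,
      Real.cosh (dist q (γ₂ t)) = a * Real.cosh t + b * Real.sinh t + e) (s t : ℝ) :
    Real.cosh (dist (γ₁ s) (γ₂ t)) + Real.cosh (dist (γ₁ (-s)) (γ₂ t)) =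
      Real.cosh (dist (γ₁ s) (γ₂ (-t))) + Real.cosh (dist (γ₁ (-s)) (γ₂ (-t))) := by
  obtain ⟨a, b, e, ha⟩ := h (γ₁ s)
  obtain ⟨a', b', e', ha'⟩ := h (γ₁ (-s))
  -- With x, y the two distances, cosh x + cosh y = 2 cosh((x + y)/2) cosh((x - y)/2) ≥ 2 cosh s,
  -- since x + y ≥ 2|s| by the triangle inequality through γ₂(t). Equality holds at t = 0.
  have hmin : IsMinOn (fun t => (a + a') * Real.cosh t + (b + b') * Real.sinh t + (e + e'))
      univ 0 := by
    intro t _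
    have hsplit : ∀ t, (a + a') * Real.cosh t + (b + b') * Real.sinh t + (e + e') =
        Real.cosh (dist (γ₁ s) (γ₂ t)) + Real.cosh (dist (γ₁ (-s)) (γ₂ t)) := fun t => by
      rw [ha, ha']
      ring
    change (a + a') * Real.cosh 0 + (b + b') * Real.sinh 0 + (e + e') ≤
      (a + a') * Real.cosh t + (b + b') * Real.sinh t + (e + e')
    rw [hsplit, hsplit, ← h0, h₁, h₁]
    set x := dist (γ₁ s) (γ₂ t)
    set y := dist (γ₁ (-s)) (γ₂ t)
    have hxy : |s| ≤ |(x + y) / 2| := by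
      have h2 := dist_triangle_right (γ₁ s) (γ₁ (-s)) (γ₂ t)
      rw [h₁, show s - -s = 2 * s by ring, abs_mul, abs_two] at h2
      exact le_trans (by linarith) (le_abs_self _)
    have hle := Real.cosh_le_cosh.2 hxy
    have hsum : Real.cosh x + Real.cosh y =
        2 * Real.cosh ((x + y) / 2) * Real.cosh ((x - y) / 2) := by
      have e1 := Real.cosh_add ((x + y) / 2) ((x - y) / 2)
      have e2 := Real.cosh_sub ((x + y) / 2) ((x - y) / 2)
      rw [show (x + y) / 2 + (x - y) / 2 = x by ring] at e1
      rw [show (x + y) / 2 - (x - y) / 2 = y by ring] at e2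
      rw [e1, e2]
      ring
    rw [hsum, sub_zero, sub_zero, Real.cosh_abs, Real.cosh_abs, Real.cosh_neg]
    nlinarith [Real.one_le_cosh ((x - y) / 2), Real.cosh_pos ((x + y) / 2)]
  have hderiv : HasDerivAt
      (fun t => (a + a') * Real.cosh t + (b + b') * Real.sinh t + (e + e'))
      ((a + a') * Real.sinh 0 + (b + b') * Real.cosh 0) 0 :=
    (((Real.hasDerivAt_cosh 0).const_mul _).add
      ((Real.hasDerivAt_sinh 0).const_mul _)).add_const _
  have hb := (hmin.isLocalMin Filter.univ_mem).hasDerivAt_eq_zero hderiv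
  rw [Real.sinh_zero, Real.cosh_zero] at hb
  rw [ha, ha, ha', ha', Real.cosh_neg, Real.sinh_neg]
  linear_combination 2 * Real.sinh t * hb

/-- The evenness relation for (γ₁, γ₂) and the one for (γ₂, γ₁) add up so that the mixed terms
cancel. -/
theorem dist_neg_neg (h₁ : ∀ s t, dist (γ₁ s) (γ₁ t) = |s - t|)
    (h₂ : ∀ s t, dist (γ₂ s) (γ₂ t) = |s - t|) (h0 : γ₁ 0 = γ₂ 0)
    (hc₁ : ∀ q : M, ∃ a b e : ℝ, ∀ t,
      Real.cosh (dist q (γ₁ t)) = a * Real.cosh t + b * Real.sinh t + e)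
    (hc₂ : ∀ q : M, ∃ a b e : ℝ, ∀ t,
      Real.cosh (dist q (γ₂ t)) = a * Real.cosh t + b * Real.sinh t + e) (s t : ℝ) :
    dist (γ₁ (-s)) (γ₂ (-t)) = dist (γ₁ s) (γ₂ t) := by
  have e1 := cosh_dist_add_cosh_dist_neg h₁ h0 hc₂ s t
  have e2 := cosh_dist_add_cosh_dist_neg h₂ h0.symm hc₁ t s
  simp only [dist_comm (γ₂ _)] at e2
  exact Real.cosh_injOn dist_nonneg dist_nonneg (by linarith)

/-- If all geodesics are minimizing, any two points lie on a geodesic, and `cosh` of the distance to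
a point is a combination of `cosh`, `sinh` and `1` on each geodesic, then `M` is symmetric. -/
theorem isSymmetricSpace_of_cosh_dist
    (hline : ∀ p q : M, ∃ γ : ℝ → M, IsGeodesic γ ∧ γ 0 = p ∧ γ (dist p q) = q)
    (hmin : ∀ γ : ℝ → M, IsGeodesic γ → ∀ s t, dist (γ s) (γ t) = |s - t|)
    (hcosh : ∀ γ : ℝ → M, IsGeodesic γ → ∀ q : M, ∃ a b e : ℝ, ∀ t,
      Real.cosh (dist q (γ t)) = a * Real.cosh t + b * Real.sinh t + e) :
    IsSymmetricSpace M := by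
  intro p
  choose Γ hΓ hΓ0 hΓp using hline p
  have hdist : ∀ γ₁ γ₂ : ℝ → M, IsGeodesic γ₁ → IsGeodesic γ₂ → γ₁ 0 = γ₂ 0 → ∀ s t,
      dist (γ₁ (-s)) (γ₂ (-t)) = dist (γ₁ s) (γ₂ t) := fun γ₁ γ₂ h₁ h₂ h0 =>
    dist_neg_neg (hmin γ₁ h₁) (hmin γ₂ h₂) h0 (hcosh γ₁ h₁) (hcosh γ₂ h₂)
  let σ : M → M := fun x => Γ x (-dist p x)
  -- The reflection does not depend on the chosen geodesic: two geodesics from `p` that meet at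
  -- parameters r and t also meet at -r and -t.
  have hσ : ∀ γ : ℝ → M, IsGeodesic γ → γ 0 = p → ∀ t, σ (γ t) = γ (-t) := by
    intro γ hγ h0 t
    rw [← dist_eq_zero, hdist _ _ (hΓ _) hγ ((hΓ0 _).trans h0.symm), hΓp, dist_self]
  have hσσ : ∀ x, σ (σ x) = x := fun x => by
    rw [hσ (Γ x) (hΓ x) (hΓ0 x), neg_neg, hΓp]
  have hiso : Isometry σ := Isometry.of_dist_eq fun x y => by
    rw [hdist _ _ (hΓ x) (hΓ y) ((hΓ0 x).trans (hΓ0 y).symm), hΓp, hΓp]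
  refine ⟨IsometryEquiv.mk' σ σ hσσ hiso, ?_, hσ⟩
  change Γ p (-dist p p) = p
  rw [dist_self, neg_zero, hΓ0]

end Symmetry

/-! ### Charts are isometric to first order at their centre. -/

section ChartComparison

open Filter Topology
open scoped ENNReal NNReal

theorem enorm_le_mul_of_norm_le {V W : Type*} [NormedAddCommGroup V] [NormedAddCommGroup W]
    {κ : ℝ≥0} {v : V} {w : W} (h : ‖v‖ ≤ κ * ‖w‖) : ‖v‖ₑ ≤ κ * ‖w‖ₑ := by
  rw [← ofReal_norm, ← ofReal_norm, ← ENNReal.ofReal_coe_nnreal,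
    ← ENNReal.ofReal_mul κ.coe_nonneg]
  exact ENNReal.ofReal_le_ofReal h

variable {E : Type*} [NormedAddCommGroup E] [NormedSpace ℝ E]
  {M : Type*} [MetricSpace M] [ChartedSpace E M]
  [RiemannianBundle (fun x : M => TangentSpace 𝓘(ℝ, E) x)]

theorem dist_lt_of_path [IsRiemannianManifold 𝓘(ℝ, E) M] {γ : ℝ → M} {a b L : ℝ}
    (hγ : CMDiff[Icc a b] 1 γ) (hab : a ≤ b)
    (hL : pathELength 𝓘(ℝ, E) γ a b < ENNReal.ofReal L) : dist (γ a) (γ b) < L := by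
  have h := (riemannianEDist_le_pathELength hγ rfl rfl hab).trans_lt hL
  rw [← IsRiemannianManifold.out, edist_dist] at h
  exact (ENNReal.ofReal_lt_ofReal_iff_of_nonneg dist_nonneg).1 h

theorem exists_path_of_dist_lt [IsRiemannianManifold 𝓘(ℝ, E) M] {x y : M} {L : ℝ}
    (h : dist x y < L) : ∃ γ : ℝ → M, γ 0 = x ∧ γ 1 = y ∧ CMDiff[Icc 0 1] 1 γ ∧
      pathELength 𝓘(ℝ, E) γ 0 1 < ENNReal.ofReal L := by
  refine exists_lt_of_riemannianEDist_lt ?_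
  rw [← IsRiemannianManifold.out, edist_dist]
  exact (ENNReal.ofReal_lt_ofReal_iff_of_nonneg dist_nonneg).2 h

/-- A Riemannian manifold is a length space. -/
theorem exists_dist_eq_dist_lt [IsRiemannianManifold 𝓘(ℝ, E) M] (x y : M) (s : ℝ) (hs : 0 < s)
    (hsy : s < dist x y) (ε : ℝ) (hε : 0 < ε) :
    ∃ z, dist x z = s ∧ dist z y < dist x y - s + ε := by
  obtain ⟨γ, h0, h1, hγ, hL⟩ := exists_path_of_dist_lt (E := E)
    (show dist x y < dist x y + ε by linarith)
  have hcont : ContinuousOn (fun t => dist x (γ t)) (Icc 0 1) :=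
    (continuous_const.dist continuous_id).comp_continuousOn hγ.continuousOn
  -- A nearly shortest path crosses the sphere of radius `s` about `x`. Its part before the crossing
  -- has length at least `s`, which bounds the length of the rest.
  obtain ⟨t, ht, hts⟩ := intermediate_value_Icc zero_le_one hcont
    (show s ∈ Icc (dist x (γ 0)) (dist x (γ 1)) by
      rw [h0, h1, dist_self]; exact ⟨hs.le, hsy.le⟩)
  refine ⟨γ t, hts, ?_⟩
  have hs_le : ENNReal.ofReal s ≤ pathELength 𝓘(ℝ, E) γ 0 t := by
    rw [← hts, ← edist_dist, IsRiemannianManifold.out (I := 𝓘(ℝ, E))]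
    exact riemannianEDist_le_pathELength (hγ.mono (Icc_subset_Icc_right ht.2)) h0 rfl ht.1
  rw [← pathELength_add ht.1 ht.2] at hL
  conv_lhs => rw [← h1]
  refine dist_lt_of_path (E := E) (hγ.mono (Icc_subset_Icc_left ht.1)) ht.2 ?_
  have h2 := (add_le_add hs_le le_rfl).trans_lt hL
  rw [show dist x y + ε = s + (dist x y - s + ε) by ring,
    ENNReal.ofReal_add hs.le (by linarith)] at h2
  exact (ENNReal.add_lt_add_iff_left ENNReal.ofReal_ne_top).1 h2

variable [IsManifold 𝓘(ℝ, E) ∞ M]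

variable (E) in
/-- The identification of the model space with the tangent space at `x` through the preferred
chart. -/
noncomputable def chartFrame (x : M) : E →L[ℝ] TangentSpace 𝓘(ℝ, E) x :=
  (trivializationAt E (TangentSpace 𝓘(ℝ, E)) x).symmL ℝ x

variable [IsContinuousRiemannianBundle E (fun x : M => TangentSpace 𝓘(ℝ, E) x)]

/-- Continuity of the metric: near `x`, its norms are within the factor κ of the fixed norm on the
tangent space at `x`. -/
theorem eventually_enorm_mfderiv_symm_le (x : M) {κ : ℝ≥0} (hκ : 1 < κ) :
    ∀ᶠ z in 𝓝 (extChartAt 𝓘(ℝ, E) x x), ∀ u : E,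
      ‖mfderiv[range 𝓘(ℝ, E)] (extChartAt 𝓘(ℝ, E) x).symm z u‖ₑ ≤ κ * ‖chartFrame E x u‖ₑ := by
  have h := eventually_norm_symmL_trivializationAt_comp_self_lt E
    (fun x : M => TangentSpace 𝓘(ℝ, E) x) x (r := κ) (by exact_mod_cast hκ)
  have hc : Tendsto (extChartAt 𝓘(ℝ, E) x).symm (𝓝 (extChartAt 𝓘(ℝ, E) x x)) (𝓝 x) := by
    have := (continuousAt_extChartAt_symm (I := 𝓘(ℝ, E)) x).tendsto
    rwa [extChartAt_to_inv] at this
  filter_upwards [hc.eventually h, extChartAt_target_mem_nhds (I := 𝓘(ℝ, E)) x] with z hz hzt u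
  have hsrc : (extChartAt 𝓘(ℝ, E) x).symm z ∈ (chartAt E x).source := by
    have := (extChartAt 𝓘(ℝ, E) x).map_target hzt
    rwa [extChartAt_source] at this
  have hx : x ∈ (trivializationAt E (TangentSpace 𝓘(ℝ, E)) x).baseSet :=
    FiberBundle.mem_baseSet_trivializationAt' x
  have hu : (trivializationAt E (TangentSpace 𝓘(ℝ, E)) x).continuousLinearMapAt ℝ x
      (chartFrame E x u) = u :=
    (trivializationAt E (TangentSpace 𝓘(ℝ, E)) x).continuousLinearMapAt_symmL hx u
  have hle := ContinuousLinearMap.le_of_opNorm_le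
    (((trivializationAt E (TangentSpace 𝓘(ℝ, E)) x).symmL ℝ ((extChartAt 𝓘(ℝ, E) x).symm z)) ∘L
      (trivializationAt E (TangentSpace 𝓘(ℝ, E)) x).continuousLinearMapAt ℝ x) hz.le (chartFrame E x u)
  rw [ContinuousLinearMap.comp_apply, hu, TangentBundle.symmL_trivializationAt hsrc,
    (extChartAt 𝓘(ℝ, E) x).right_inv hzt] at hle
  exact enorm_le_mul_of_norm_le hle

theorem eventually_enorm_chartFrame_mfderiv_le (x : M) {κ : ℝ≥0} (hκ : 1 < κ) :
    ∀ᶠ y in 𝓝 x, ∀ v : TangentSpace 𝓘(ℝ, E) y,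
      ‖chartFrame E x (mfderiv% (extChartAt 𝓘(ℝ, E) x) y v)‖ₑ ≤ κ * ‖v‖ₑ := by
  have h := eventually_norm_symmL_trivializationAt_self_comp_lt E
    (fun x : M => TangentSpace 𝓘(ℝ, E) x) x (r := κ) (by exact_mod_cast hκ)
  filter_upwards [h, chart_source_mem_nhds E x] with y hy hsrc v
  have hle := ContinuousLinearMap.le_of_opNorm_le _ hy.le v
  rw [ContinuousLinearMap.comp_apply,
    TangentBundle.continuousLinearMapAt_trivializationAt hsrc] at hle
  exact enorm_le_mul_of_norm_le hle

/-- The chart at `x` shrinks the metric of the tangent space at `x` by a factor arbitrarily close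
to one. -/
theorem eventually_dist_symm_le [IsRiemannianManifold 𝓘(ℝ, E) M] (x : M) {κ : ℝ} (hκ : 1 < κ) :
    ∀ᶠ u in 𝓝 (0 : E), dist x ((extChartAt 𝓘(ℝ, E) x).symm (extChartAt 𝓘(ℝ, E) x x + u)) ≤
      κ * ‖chartFrame E x u‖ := by
  lift κ to ℝ≥0 using by linarith
  obtain ⟨r, hr, hball⟩ := Metric.mem_nhds_iff.1
    (inter_mem (extChartAt_target_mem_nhds (I := 𝓘(ℝ, E)) x)
      (eventually_enorm_mfderiv_symm_le x (κ := κ) (by exact_mod_cast hκ)))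
  filter_upwards [Metric.ball_mem_nhds 0 hr] with u hu
  set z₀ := extChartAt 𝓘(ℝ, E) x x
  -- The distance is bounded by the length of the image of the straight segment in the chart.
  let η : ℝ → E := fun t => z₀ + t • u
  have hη : ∀ t ∈ Icc (0 : ℝ) 1, η t ∈ Metric.ball z₀ r := by
    intro t ht
    rw [Metric.mem_ball, dist_eq_norm, add_sub_cancel_left, norm_smul, Real.norm_eq_abs,
      abs_of_nonneg ht.1]
    rw [mem_ball_zero_iff] at hu
    nlinarith [norm_nonneg u, ht.2]
  have hηd : ∀ t, HasDerivAt η u t := fun t => by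
    have := ((hasDerivAt_id t).smul_const u).const_add z₀
    rwa [one_smul] at this
  have hηs : CMDiff[Icc 0 1] 1 η := by
    refine ContMDiff.contMDiffOn ?_
    rw [contMDiff_iff_contDiff]
    fun_prop
  set γ : ℝ → M := (extChartAt 𝓘(ℝ, E) x).symm ∘ η
  have hγ : CMDiff[Icc 0 1] 1 γ :=
    (contMDiffOn_extChartAt_symm x).comp hηs fun t ht => (hball (hη t ht)).1
  have hlen : riemannianEDist 𝓘(ℝ, E) x ((extChartAt 𝓘(ℝ, E) x).symm (z₀ + u)) ≤
      pathELength 𝓘(ℝ, E) γ 0 1 :=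
    riemannianEDist_le_pathELength hγ (by simp [γ, η, z₀]) (by simp [γ, η]) zero_le_one
  have hint : pathELength 𝓘(ℝ, E) γ 0 1 ≤ κ * ‖chartFrame E x u‖ₑ := by
    rw [pathELength_eq_lintegral_mfderivWithin_Icc]
    calc _ ≤ ∫⁻ _ in Icc (0 : ℝ) 1, κ * ‖chartFrame E x u‖ₑ := by
          refine setLIntegral_mono' measurableSet_Icc fun t ht => ?_
          have hcomp : mfderiv[Icc 0 1] γ t =
              (mfderiv[range 𝓘(ℝ, E)] (extChartAt 𝓘(ℝ, E) x).symm (η t)) ∘L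
                (mfderiv[Icc 0 1] η t) := by
            refine mfderivWithin_comp _ ?_ ?_ ?_ ?_
            · exact mdifferentiableWithinAt_extChartAt_symm (hball (hη t ht)).1
            · exact hηs.mdifferentiableOn one_ne_zero t ht
            · intro s _
              simp
            · rw [uniqueMDiffWithinAt_iff_uniqueDiffWithinAt]
              exact uniqueDiffOn_Icc zero_lt_one t ht
          have hη1 : mfderiv[Icc 0 1] η t (1 : ℝ) = u := by
            rw [mfderivWithin_eq_fderivWithin]
            exact (fderivWithin_derivWithin (𝕜 := ℝ) (F := E)).trans
              ((hηd t).hasDerivWithinAt.derivWithin (uniqueDiffOn_Icc zero_lt_one t ht))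
          have h1 : mfderiv[Icc 0 1] γ t (1 : ℝ) =
              mfderiv[range 𝓘(ℝ, E)] (extChartAt 𝓘(ℝ, E) x).symm (η t) u :=
            (congr($hcomp (1 : ℝ))).trans
              (congrArg (mfderiv[range 𝓘(ℝ, E)] (extChartAt 𝓘(ℝ, E) x).symm (η t)) hη1)
          exact (congrArg enorm h1).trans_le ((hball (hη t ht)).2 u)
      _ = κ * ‖chartFrame E x u‖ₑ := by simp
  have h := hlen.trans hint
  rw [← IsRiemannianManifold.out (I := 𝓘(ℝ, E)), edist_dist, ← ofReal_norm,
    ← ENNReal.ofReal_coe_nnreal, ← ENNReal.ofReal_mul κ.coe_nonneg] at h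
  exact (ENNReal.ofReal_le_ofReal_iff (by positivity)).1 h

/-- The chart at `x` stretches the metric of the tangent space at `x` by a factor arbitrarily close
to one. -/
theorem eventually_norm_chartFrame_sub_le [IsRiemannianManifold 𝓘(ℝ, E) M] (x : M) {κ : ℝ}
    (hκ : 1 < κ) : ∀ᶠ y in 𝓝 x,
      ‖chartFrame E x (extChartAt 𝓘(ℝ, E) x y - extChartAt 𝓘(ℝ, E) x x)‖ ≤ κ * dist x y := by
  lift κ to ℝ≥0 using by linarith
  obtain ⟨ρ, hρ, hball⟩ := Metric.mem_nhds_iff.1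
    (inter_mem (chart_source_mem_nhds E x)
      (eventually_enorm_chartFrame_mfderiv_le (E := E) x (κ := κ) (by exact_mod_cast hκ)))
  filter_upwards [Metric.ball_mem_nhds x hρ] with y hy
  rw [Metric.mem_ball'] at hy
  -- A path of length less than `L` from `x` stays in the ball of radius `ρ`, where the derivative
  -- of the chart is controlled; `L` then decreases to the distance.
  have key : ∀ L, dist x y < L → L < ρ →
      ‖chartFrame E x (extChartAt 𝓘(ℝ, E) x y - extChartAt 𝓘(ℝ, E) x x)‖ ≤ κ * L := by
    intro L hL hLρ
    obtain ⟨γ, h0, h1, hγ, hlen⟩ := exists_path_of_dist_lt (E := E) hL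
    have hmem : ∀ t ∈ Icc (0 : ℝ) 1, γ t ∈ Metric.ball x ρ := by
      intro t ht
      rw [Metric.mem_ball', ← h0]
      refine (dist_lt_of_path (E := E) (hγ.mono (Icc_subset_Icc_right ht.2)) ht.1 ?_).trans hLρ
      exact (pathELength_mono le_rfl ht.2).trans_lt hlen
    have hφ : CMDiff[Icc 0 1] 1 (extChartAt 𝓘(ℝ, E) x ∘ γ) :=
      contMDiffOn_extChartAt.comp hγ fun t ht => (hball (hmem t ht)).1
    rw [contMDiffOn_iff_contDiffOn] at hφ
    let φ : ℝ → TangentSpace 𝓘(ℝ, E) x := fun t => chartFrame E x (extChartAt 𝓘(ℝ, E) x (γ t))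
    have hφs : ContDiffOn ℝ 1 φ (Icc 0 1) := (chartFrame E x).contDiff.comp_contDiffOn hφ
    have hle := enorm_sub_le_lintegral_derivWithin_Icc_of_contDiffOn_Icc hφs zero_le_one
    have hint : ∫⁻ t in Icc (0 : ℝ) 1, ‖derivWithin φ (Icc 0 1) t‖ₑ ≤
        κ * pathELength 𝓘(ℝ, E) γ 0 1 := by
      rw [pathELength_eq_lintegral_mfderivWithin_Icc,
        ← lintegral_const_mul' _ _ ENNReal.coe_ne_top]
      refine setLIntegral_mono' measurableSet_Icc fun t ht => ?_
      have hu := uniqueDiffOn_Icc (zero_lt_one (α := ℝ)) t ht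
      have hcomp : mfderiv[Icc 0 1] (extChartAt 𝓘(ℝ, E) x ∘ γ) t =
          (mfderiv% (extChartAt 𝓘(ℝ, E) x) (γ t)) ∘L (mfderiv[Icc 0 1] γ t) := by
        refine mfderiv_comp_mfderivWithin _ ?_ ?_ ?_
        · exact mdifferentiableAt_extChartAt (hball (hmem t ht)).1
        · exact hγ.mdifferentiableOn one_ne_zero t ht
        · rw [uniqueMDiffWithinAt_iff_uniqueDiffWithinAt]
          exact hu
      have hd : derivWithin φ (Icc 0 1) t =
          chartFrame E x (mfderiv% (extChartAt 𝓘(ℝ, E) x) (γ t) (mfderiv[Icc 0 1] γ t (1 : ℝ))) := by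
        have h2 := ((hφ.differentiableOn one_ne_zero t ht).hasFDerivWithinAt)
        rw [← mfderivWithin_eq_fderivWithin, hcomp] at h2
        have h3 := ((chartFrame E x).hasFDerivAt.comp_hasFDerivWithinAt t h2).hasDerivWithinAt
        exact h3.derivWithin hu
      rw [hd]
      exact (hball (hmem t ht)).2 _
    have h := (hle.trans hint).trans (mul_le_mul_right hlen.le _)
    simp only [φ, h0, h1, ← map_sub] at h
    rw [← ofReal_norm, ← ENNReal.ofReal_coe_nnreal, ← ENNReal.ofReal_mul κ.coe_nonneg] at h
    exact (ENNReal.ofReal_le_ofReal_iff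
      (mul_nonneg κ.coe_nonneg (dist_nonneg.trans hL.le))).1 h
  have hlim : Tendsto (fun L : ℝ => κ * L) (𝓝[>] dist x y) (𝓝 (κ * dist x y)) :=
    ((continuous_const.mul continuous_id).tendsto _).mono_left nhdsWithin_le_nhds
  refine ge_of_tendsto hlim ?_
  filter_upwards [Ioo_mem_nhdsGT hy] with L hL
  exact key L hL.1 hL.2

end ChartComparison

/-! ### Slope of a differentiable distance function. -/

section Slope

open Filter Topology

variable {E : Type*} [NormedAddCommGroup E] [NormedSpace ℝ E]
  {M : Type*} [MetricSpace M] [ChartedSpace E M]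
  [RiemannianBundle (fun x : M => TangentSpace 𝓘(ℝ, E) x)]
  [IsManifold 𝓘(ℝ, E) ∞ M]

/-- Differentiability in the chart has its error measured by the norm of the model space; this
converts the error to the Riemannian norm at `x`. -/
theorem exists_norm_le_chartFrame (x : M) :
    ∃ C > 0, ∀ u : E, ‖u‖ ≤ C * ‖chartFrame E x u‖ := by
  refine ⟨‖(trivializationAt E (TangentSpace 𝓘(ℝ, E)) x).continuousLinearMapAt ℝ x‖ + 1,
    by positivity, fun u => ?_⟩
  have hx : x ∈ (trivializationAt E (TangentSpace 𝓘(ℝ, E)) x).baseSet :=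
    FiberBundle.mem_baseSet_trivializationAt' x
  have hu : (trivializationAt E (TangentSpace 𝓘(ℝ, E)) x).continuousLinearMapAt ℝ x
      (chartFrame E x u) = u :=
    (trivializationAt E (TangentSpace 𝓘(ℝ, E)) x).continuousLinearMapAt_symmL hx u
  have hle := ContinuousLinearMap.le_opNorm
    ((trivializationAt E (TangentSpace 𝓘(ℝ, E)) x).continuousLinearMapAt ℝ x) (chartFrame E x u)
  rw [hu] at hle
  linarith [norm_nonneg (chartFrame E x u)]

variable [IsContinuousRiemannianBundle E (fun x : M => TangentSpace 𝓘(ℝ, E) x)]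
  [IsRiemannianManifold 𝓘(ℝ, E) M] [LocallyCompactSpace M]

/-- Where the distance from `p` is differentiable, it increases with slope one in some direction:
the one opposite to a segment towards `p`. -/
theorem frequently_slope_dist {p x : M} (hx : x ≠ p)
    (hd : DifferentiableAt ℝ (fun z => dist p ((extChartAt 𝓘(ℝ, E) x).symm z))
      (extChartAt 𝓘(ℝ, E) x x)) {κ : ℝ} (hκ : κ < 1) :
    ∃ᶠ w in 𝓝 x, κ * dist x w < dist p w - dist p x := by
  intro hev
  obtain ⟨C, hC, hCu⟩ := exists_norm_le_chartFrame (E := E) x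
  set e := extChartAt 𝓘(ℝ, E) x with he
  -- The chart distortion `k` enters twice: from the manifold to the chart and, after reflection,
  -- back again.
  obtain ⟨k, hk1, hk⟩ : ∃ k : ℝ, 1 < k ∧ max κ 0 * (k * k) < 1 := by
    have hcont : Tendsto (fun k : ℝ => max κ 0 * (k * k)) (𝓝[>] 1) (𝓝 (max κ 0 * (1 * 1))) :=
      ((by fun_prop : Continuous fun k : ℝ => max κ 0 * (k * k)).tendsto 1).mono_left
        nhdsWithin_le_nhds
    obtain ⟨k, hk, hk'⟩ := ((hcont.eventually_lt_const (show _ < (1 : ℝ) by simpa using hκ)).and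
      self_mem_nhdsWithin).exists
    exact ⟨k, hk', hk⟩
  set θ := 1 - max κ 0 * (k * k)
  have hθ : 0 < θ := sub_pos.2 hk
  have hk0 : 0 < k := one_pos.trans hk1
  have ho := ((hasFDerivAt_iff_isLittleO_nhds_zero.1 hd.hasFDerivAt).def
    (show 0 < θ / (4 * (C * k)) by positivity))
  set D := fderiv ℝ (fun z => dist p (e.symm z)) (e x)
  have hlim : Tendsto (fun z => e z - e x) (𝓝 x) (𝓝 0) := by
    have := (continuousAt_extChartAt (I := 𝓘(ℝ, E)) x).tendsto.sub_const (e x)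
    rwa [sub_self] at this
  have hlim' : Tendsto (fun z => -(e z - e x)) (𝓝 x) (𝓝 0) := by
    simpa using hlim.neg
  have hsymm : Tendsto (fun u => e.symm (e x + u)) (𝓝 0) (𝓝 x) := by
    have h1 : Tendsto (fun u => e x + u) (𝓝 0) (𝓝 (e x)) :=
      (by fun_prop : Continuous fun u => e x + u).tendsto' _ _ (by simp)
    have h2 := (continuousAt_extChartAt_symm (I := 𝓘(ℝ, E)) x).tendsto.comp h1
    rwa [extChartAt_to_inv] at h2
  obtain ⟨δ, hδ, hball⟩ := Metric.eventually_nhds_iff.1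
    ((eventually_norm_chartFrame_sub_le (E := E) x hk1).and
      ((hlim'.eventually (eventually_dist_symm_le x hk1)).and
        ((hlim.eventually ho).and ((hlim'.eventually ho).and
          ((hlim'.eventually (hsymm.eventually hev)).and
            (extChartAt_source_mem_nhds (I := 𝓘(ℝ, E)) x))))))
  -- Take `z` at distance `s` from `x` towards `p`, and let `w` be its reflection through `x` in the
  -- chart. The linear part of d(p, ·) changes sign, so the drop `s` at `z` becomes a rise of nearly
  -- `s` at `w`, while d(x, w) ≤ k²s.
  obtain ⟨s, hs, hs0, hs'⟩ := ((eventually_exists_dist_eq (exists_dist_eq_dist_lt (E := E)) x).and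
    (Ioo_mem_nhdsGT (lt_min hδ (dist_pos.2 hx)))).exists
  obtain ⟨z, hz, hzp⟩ := hs p (hs'.trans_le (min_le_right _ _))
  obtain ⟨b1, b2, b3, b4, b5, b6⟩ := hball
    (show dist z x < δ by rw [dist_comm, hz]; exact hs'.trans_le (min_le_left _ _))
  rw [← he] at b1 b2 b6
  set u := e z - e x
  rw [hz] at b1
  rw [map_neg, norm_neg] at b2
  rw [map_neg, norm_neg] at b4
  rw [show e x + u = e z by simp [u], e.left_inv b6] at b3
  have hxe : e.symm (e x) = x := e.left_inv (mem_extChartAt_source x)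
  rw [hxe, dist_comm p z, hzp, Real.norm_eq_abs, dist_comm x p] at b3
  rw [hxe, Real.norm_eq_abs] at b4
  set w := e.symm (e x + -u)
  -- The error at each of `z` and `w` is at most θs/4, so the rise is at least (1 - θ/2)s, which
  -- exceeds (1 - θ)s.
  have hu : θ / (4 * (C * k)) * ‖u‖ ≤ θ / 4 * s := by
    have h1 : ‖u‖ ≤ C * (k * s) := (hCu u).trans (mul_le_mul_of_nonneg_left b1 hC.le)
    calc θ / (4 * (C * k)) * ‖u‖ ≤ θ / (4 * (C * k)) * (C * (k * s)) := by gcongr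
      _ = θ / 4 * s := by field_simp
  have h3 := abs_le.1 b3
  have h4 := abs_le.1 b4
  have hup : s - θ / 2 * s ≤ dist p w - dist p x := by linarith [h3.1, h3.2, h4.1, h4.2]
  have hw : κ * dist x w ≤ max κ 0 * (k * k) * s := by
    have h1 : dist x w ≤ k * (k * s) := b2.trans (mul_le_mul_of_nonneg_left b1 hk0.le)
    calc κ * dist x w ≤ max κ 0 * dist x w := by gcongr; exact le_max_left _ _
      _ ≤ max κ 0 * (k * (k * s)) := by gcongr
      _ = _ := by ring
  refine b5 (hw.trans_lt (lt_of_lt_of_le ?_ hup))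
  have : max κ 0 * (k * k) = 1 - θ := by simp [θ]
  rw [this]
  nlinarith

end Slope

theorem nontrivial_of_noncompactSpace (M : Type*) [TopologicalSpace M] [NoncompactSpace M] :
    Nontrivial M := by
  rw [← not_subsingleton_iff_nontrivial]
  intro h
  exact noncompact_univ M Set.subsingleton_univ.isCompact

/-- If `cosh r + c` is smooth, then `r` is differentiable away from its centre. -/
theorem differentiableAt_dist_of_contMDiff {n : ℕ} {M : Type*} [MetricSpace M]
    [ChartedSpace (EuclideanSpace ℝ (Fin n)) M] [IsManifold (𝓡 n) ∞ M] {c : ℝ} {p x : M} (hx : x ≠ p)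
    (h : ContMDiff (𝓡 n) 𝓘(ℝ, ℝ) ∞ (coshDist c p)) :
    DifferentiableAt ℝ (fun z => dist p ((extChartAt (𝓡 n) x).symm z)) (extChartAt (𝓡 n) x x) := by
  have h1 : DifferentiableAt ℝ (fun z => coshDist c p ((extChartAt (𝓡 n) x).symm z))
      (extChartAt (𝓡 n) x x) := by
    have h2 := (h.comp_contMDiffOn (contMDiffOn_extChartAt_symm x)).contMDiffAt
      (extChartAt_target_mem_nhds (I := 𝓡 n) x)
    exact (contMDiffAt_iff_contDiffAt.1 h2).differentiableAt (by simp)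
  -- The inverse `Real.arcosh` is differentiated at cosh d(p, x), which exceeds 1 because x ≠ p.
  have h3 : (fun z => dist p ((extChartAt (𝓡 n) x).symm z)) = fun z =>
      Real.arcosh (coshDist c p ((extChartAt (𝓡 n) x).symm z) - c) := by
    funext z
    rw [coshDist, add_sub_cancel_right, Real.arcosh_cosh dist_nonneg]
  rw [h3]
  refine DifferentiableAt.comp (g := Real.arcosh) _ (Real.differentiableAt_arcosh ?_)
    (h1.sub_const c)
  rw [extChartAt_to_inv, coshDist, add_sub_cancel_right]
  exact Real.one_lt_cosh.2 (dist_pos.2 hx.symm).ne'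

/-! ### Smoothness of the radial functions. -/

section Eigenfunctions

variable {n : ℕ} {M : Type*} [MetricSpace M] [ChartedSpace (EuclideanSpace ℝ (Fin n)) M]
  [RiemannianBundle (fun x : M => TangentSpace (𝓡 n) x)]

theorem expMap_zero (p : M) : expMap (n := n) p 0 = p := by
  unfold expMap
  split_ifs with h
  · exact (congrArg h.choose norm_zero).trans h.choose_spec.2.1
  · rfl

theorem sphericalMean_self (hn : n ≠ 0) (p : M) (f : M → ℝ) : sphericalMean n p f p = f p := by
  have : NeZero n := ⟨hn⟩
  have : Nontrivial (EuclideanSpace ℝ (Fin n)) := by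
    rw [← Module.finrank_pos_iff (R := ℝ), finrank_euclideanSpace_fin]
    exact Nat.pos_of_ne_zero hn
  have : NeZero (volume : Measure (EuclideanSpace ℝ (Fin n))).toSphere :=
    ⟨Measure.toSphere_ne_zero _⟩
  simp [sphericalMean, normalParam, expMap_zero]

/-- A zero-dimensional manifold is discrete, whereas a length space with two points has points at
every small distance. In dimension zero the unit sphere is empty and the spherical mean would no
longer recover the value at the centre. -/
theorem dimension_ne_zero [IsRiemannianManifold (𝓡 n) M] [NoncompactSpace M] : n ≠ 0 := by
  rintro rfl
  obtain ⟨x, y, hxy⟩ := nontrivial_of_noncompactSpace M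
  have hopen : {x} ∈ nhds x := by
    refine Filter.mem_of_superset (chart_source_mem_nhds (EuclideanSpace ℝ (Fin 0)) x) fun z hz => ?_
    exact (chartAt (EuclideanSpace ℝ (Fin 0)) x).injOn hz (mem_chart_source _ x)
      (Subsingleton.elim _ _)
  obtain ⟨ε, hε, hball⟩ := Metric.mem_nhds_iff.1 hopen
  obtain ⟨s, hs, hs'⟩ := exists_between (lt_min hε (dist_pos.2 hxy))
  obtain ⟨z, hz, -⟩ := exists_dist_eq_dist_lt (E := EuclideanSpace ℝ (Fin 0)) x y s hs
    (hs'.trans_le (min_le_right _ _)) 1 one_pos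
  have hzx : z = x := hball (show dist z x < ε by
    rw [dist_comm, hz]; exact hs'.trans_le (min_le_left _ _))
  rw [hzx, dist_self] at hz
  exact hs.ne hz

/-- Averaging preserves the value at the centre, so the multiple cannot be zero. -/
theorem exists_smul_coshDist_mem_eigenspace {lam c : ℝ} (hn : n ≠ 0)
    (hav : HasCoshAverages M n lam c) {f : M → ℝ} (hf : f ∈ eigenspace n M lam) {p : M}
    (hp : f p ≠ 0) : ∃ a : ℝ, a ≠ 0 ∧ a • coshDist c p ∈ eigenspace n M lam := by
  obtain ⟨a, ha⟩ := hav.mean_eq f hf p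
  refine ⟨a, ?_, ha ▸ hav.mean_mem f hf p⟩
  rintro rfl
  have := congrFun ha p
  rw [sphericalMean_self hn, zero_smul] at this
  exact hp this

variable [LocallyCompactSpace M] [IsRiemannianManifold (𝓡 n) M]

theorem exists_smul_coshDist_mem {lam c : ℝ} (hn : n ≠ 0) (hav : HasCoshAverages M n lam c)
    (p : M) : ∃ a : ℝ, a ≠ 0 ∧ a • coshDist c p ∈ eigenspace n M lam := by
  have step : ∀ q z : M, (∃ a : ℝ, a ≠ 0 ∧ a • coshDist c q ∈ eigenspace n M lam) →
      Real.cosh (dist q z) + c ≠ 0 → ∃ a : ℝ, a ≠ 0 ∧ a • coshDist c z ∈ eigenspace n M lam := by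
    rintro q z ⟨a, ha, h⟩ hz
    exact exists_smul_coshDist_mem_eigenspace hn hav h (mul_ne_zero ha hz)
  obtain ⟨f, hf, hf0⟩ := hav.isEigenvalue
  obtain ⟨q, hq⟩ := Function.ne_iff.1 hf0
  have hq' := exists_smul_coshDist_mem_eigenspace hn hav hf hq
  -- The eigenfunction around `q` can be averaged around any point where it does not vanish. If it
  -- vanishes at `p`, an intermediate point `z` is used: both steps are shorter than d(q, p), so
  -- cosh stays below -c.
  by_cases h : Real.cosh (dist q p) + c = 0
  · rcases eq_or_ne q p with rfl | hqp
    · exact hq'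
    obtain ⟨z, h1, h2, h3⟩ := exists_dist_add_dist_eq
      (exists_dist_eq_dist_lt (E := EuclideanSpace ℝ (Fin n))) hqp
    have hlt : ∀ t, 0 ≤ t → t < dist q p → Real.cosh t + c ≠ 0 := by
      intro t ht htlt
      have : Real.cosh t < Real.cosh (dist q p) := by
        rw [Real.cosh_lt_cosh, abs_of_nonneg ht, abs_of_nonneg dist_nonneg]
        exact htlt
      linarith
    exact step z p (step q z hq' (hlt _ h1.le (by linarith))) (hlt _ h2.le (by linarith))
  · exact step q p hq' h

theorem contMDiff_coshDist {lam c : ℝ} (hn : n ≠ 0) (hav : HasCoshAverages M n lam c)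
    (p : M) : ContMDiff (𝓡 n) 𝓘(ℝ, ℝ) ∞ (coshDist c p) := by
  obtain ⟨a, ha, h⟩ := exists_smul_coshDist_mem hn hav p
  have h' : ContMDiff (𝓡 n) 𝓘(ℝ, ℝ) ∞ ((fun _ => a⁻¹) • (a • coshDist c p)) :=
    (contMDiff_const (I := 𝓡 n) (I' := 𝓘(ℝ, ℝ)) (c := a⁻¹)).smul h.1
  refine h'.congr fun q => ?_
  simp [ha]

end Eigenfunctions

end HarmonicSpace

theorem lemma3p2 {n : ℕ} {M : Type*} [MetricSpace M]
    [ChartedSpace (EuclideanSpace ℝ (Fin n)) M] [IsManifold (𝓡 n) ∞ M]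
    [RiemannianBundle (fun x : M => TangentSpace (𝓡 n) x)]
    [IsContMDiffRiemannianBundle (𝓡 n) ∞ (EuclideanSpace ℝ (Fin n))
      (fun x : M => TangentSpace (𝓡 n) x)]
    [IsRiemannianManifold (𝓡 n) M] [CompleteSpace M] [NoncompactSpace M]
    (hM : HarmonicSpace.IsHarmonic n M) (lam c : ℝ) (hlam : lam ≠ 0) (hc : c ≠ 0)
    (hav : HarmonicSpace.HasCoshAverages M n lam c) :
    (∀ γ : ℝ → M, HarmonicSpace.IsGeodesic γ →
      Module.finrank ℝ (HarmonicSpace.curveSpan c γ) = 3 →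
        ((HarmonicSpace.form M c).restrict (HarmonicSpace.curveSpan c γ)).Nondegenerate) ∧
    ((∀ γ : ℝ → M, HarmonicSpace.IsGeodesic γ →
      Module.finrank ℝ (HarmonicSpace.curveSpan c γ) = 3) →
        HarmonicSpace.IsSymmetricSpace M) := by
  refine ⟨fun γ hγ h3 => HarmonicSpace.nondegenerate_restrict_curveSpan hc hγ h3, fun h3 => ?_⟩
  have : LocallyCompactSpace M := Manifold.locallyCompact_of_finiteDimensional (𝓡 n)
  have : IsContinuousRiemannianBundle (EuclideanSpace ℝ (Fin n))
      (fun x : M => TangentSpace (𝓡 n) x) := by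
    obtain ⟨g, hg, hg'⟩ := IsContMDiffRiemannianBundle.exists_contMDiff (IB := 𝓡 n) (n := ∞)
      (F := EuclideanSpace ℝ (Fin n)) (E := fun x : M => TangentSpace (𝓡 n) x)
    exact ⟨g, hg.continuous, hg'⟩
  have hlen := HarmonicSpace.exists_dist_eq_dist_lt (E := EuclideanSpace ℝ (Fin n)) (M := M)
  have hn : n ≠ 0 := HarmonicSpace.dimension_ne_zero (M := M)
  have := HarmonicSpace.nontrivial_of_noncompactSpace M
  have hext : ∀ p x : M, ∃ y ≠ x, dist p y = dist p x + dist x y := by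
    intro p x
    rcases eq_or_ne x p with rfl | hx
    · obtain ⟨y, hy⟩ := exists_ne x
      exact ⟨y, hy, by simp⟩
    · refine HarmonicSpace.exists_dist_eq_add_of_slope hx fun x hx κ hκ => ?_
      exact HarmonicSpace.frequently_slope_dist hx
        (HarmonicSpace.differentiableAt_dist_of_contMDiff hx
          (HarmonicSpace.contMDiff_coshDist hn hav p)) hκ
  exact HarmonicSpace.isSymmetricSpace_of_cosh_dist
    (HarmonicSpace.exists_isGeodesic
      (fun x y hxy => HarmonicSpace.exists_dist_add_dist_eq hlen hxy) hext)
    (fun γ hγ => HarmonicSpace.dist_eq_of_finrank_eq_three hc hγ (h3 γ hγ))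
    (fun γ hγ => HarmonicSpace.exists_cosh_dist_eq hc hγ (h3 γ hγ))
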